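/- Let $\Bbbk$ be a field of characteristic $0$, let $d\ge 1$, and let $A_1,\dots,A_g,N_1,\dots,N_h\in M_d(\Bbbk)$. Let $\mathcal A\subseteq M_d(\Bbbk)$ be the (not necessarily unital) $\Bbbk$-algebra generated by $A_1,\dots,A_g,N_1,\dots,N_h$, and let $\mathcal N\subseteq\mathcal A$ be the two-sided ideal of $\mathcal A$ generated by $N_1,\dots,N_h$. For $X=(X_1,\dots,X_g)\in M_n(\Bbbk)^g$ write $L_A(X)=I\otimes I-\sum_{i=1}^g A_i\otimes X_i\in M_{dn}(\Bbbk)$, where $\otimes$ is the Kronecker product. Put $\lambda(1)=1$ and $$\lambda(d)=\left\lceil d\sqrt{\frac{2d^2}{d-1}+\frac14}+\frac d2-2\right\rceil\qquad (d\ge 2).$$ (a) If for some $m\ge\lambda(d)$ the identity $$\det\Bigl(L_A(X)-\sum_{j=1}^h N_j\otimes Y_j\Bigr)=\det L_A(X)\qquad(*)$$ holds for all $X_1,\dots,X_g,Y_1,\dots,Y_h\in M_m(\Bbbk)$, then $\mathcal N$ is a nilpotent ideal, i.e. $\mathcal N^r=0$ for some $r\ge 1$. (b) Conversely, if $\mathcal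 N$ is nilpotent, then $(*)$ holds for all $n\in\mathbb N$ and all $X_1,\dots,X_g,Y_1,\dots,Y_h\in M_n(\Bbbk)$. -/

import Mathlib

open scoped Kronecker

/-- The bound `λ(d)`: it is `1` for `d = 1`, and the ceiling of
`d √(2 d² / (d - 1) + 1/4) + d/2 - 2` for `d ≥ 2`.
(The degenerate size `d = 0` is given the value `1` too.) -/
noncomputable def lengthBound (d : ℕ) : ℕ :=
  if d ≤ 1 then 1
  else ⌈(d : ℝ) * Real.sqrt (2 * (d : ℝ) ^ 2 / ((d : ℝ) - 1) + 1 / 4) + (d : ℝ) / 2 - 2⌉₊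

/-- The evaluation `L_A(X) = I ⊗ I - ∑ i, A i ⊗ X i` of the monic linear pencil with
coefficients `A` at the tuple of `n × n` matrices `X`. -/
def pencilEval {K : Type*} [Field K] {d g n : ℕ}
    (A : Fin g → Matrix (Fin d) (Fin d) K) (X : Fin g → Matrix (Fin n) (Fin n) K) :
    Matrix (Fin d × Fin n) (Fin d × Fin n) K :=
  (1 : Matrix (Fin d) (Fin d) K) ⊗ₖ (1 : Matrix (Fin n) (Fin n) K) - ∑ i, A i ⊗ₖ X i

/-- `I` is a two-sided ideal of the (possibly non-unital) `K`-subalgebra `B` of `R`: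
a `K`-subspace of `B` stable under left and right multiplication by elements of `B`. -/
structure IsIdealOf {K R : Type*} [Field K] [Ring R] [Algebra K R]
    (B : NonUnitalSubalgebra K R) (I : Submodule K R) : Prop where
  le : I ≤ B.toSubmodule
  mul_mem_left : ∀ a ∈ B, ∀ x ∈ I, a * x ∈ I
  mul_mem_right : ∀ a ∈ B, ∀ x ∈ I, x * a ∈ I

/-- The two-sided ideal of the subalgebra `B` generated by a subset `s` of `B`:
the smallest ideal of `B` that contains `s`. -/
def idealGeneratedBy {K R : Type*} [Field K] [Ring R] [Algebra K R]
    (B : NonUnitalSubalgebra K R) (s : Set R) : Submodule K R :=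
  sInf {I : Submodule K R | IsIdealOf B I ∧ s ⊆ (I : Set R)}

theorem idealGeneratedBy_isIdealOf {K R : Type*} [Field K] [Ring R] [Algebra K R]
    (B : NonUnitalSubalgebra K R) (s : Set R) (hs : s ⊆ (B : Set R)) :
    IsIdealOf B (idealGeneratedBy B s) where
  le := sInf_le ⟨⟨le_rfl, fun _ ha _ hx => B.mul_mem ha hx, fun _ ha _ hx => B.mul_mem hx ha⟩, hs⟩
  mul_mem_left := fun a ha _ hx => Submodule.mem_sInf.2 fun I hI =>
    hI.1.mul_mem_left a ha _ (Submodule.mem_sInf.1 hx I hI)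
  mul_mem_right := fun a ha _ hx => Submodule.mem_sInf.2 fun I hI =>
    hI.1.mul_mem_right a ha _ (Submodule.mem_sInf.1 hx I hI)

theorem subset_idealGeneratedBy {K R : Type*} [Field K] [Ring R] [Algebra K R]
    (B : NonUnitalSubalgebra K R) (s : Set R) : s ⊆ (idealGeneratedBy B s : Set R) :=
  fun _ hx => Submodule.mem_sInf.2 fun _ hI => hI.2 hx

/-- The (not necessarily unital) `K`-algebra of `d × d` matrices generated by
`A_1, …, A_g, N_1, …, N_h`. -/
def coeffAlgebra {K : Type*} [Field K] {d g h : ℕ}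
    (A : Fin g → Matrix (Fin d) (Fin d) K) (N : Fin h → Matrix (Fin d) (Fin d) K) :
    NonUnitalSubalgebra K (Matrix (Fin d) (Fin d) K) :=
  NonUnitalAlgebra.adjoin K (Set.range A ∪ Set.range N)

/-- The ideal of `coeffAlgebra A N` generated by `N_1, …, N_h`. -/
def coeffIdeal {K : Type*} [Field K] {d g h : ℕ}
    (A : Fin g → Matrix (Fin d) (Fin d) K) (N : Fin h → Matrix (Fin d) (Fin d) K) :
    Submodule K (Matrix (Fin d) (Fin d) K) :=
  idealGeneratedBy (coeffAlgebra A N) (Set.range N)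

theorem coeffIdeal_isIdealOf {K : Type*} [Field K] {d g h : ℕ}
    (A : Fin g → Matrix (Fin d) (Fin d) K) (N : Fin h → Matrix (Fin d) (Fin d) K) :
    IsIdealOf (coeffAlgebra A N) (coeffIdeal A N) :=
  idealGeneratedBy_isIdealOf _ _
    (Set.subset_union_right.trans (NonUnitalAlgebra.subset_adjoin K))

/-! Let `𝒜¹` be the unital algebra generated by the coefficients. (b) If `L_A(X)` is invertible, its
inverse lies in `𝒜¹ ⊗ M_n`. The perturbation then factors as `L_A(X)` times `1` plus an element of
`𝒩 ⊗ M_n`, which is nilpotent, so the determinant is unchanged. Exchanging the two pencils settles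
the singular case (`det_add_eq`).

(a) Suppose the right ideal `R = ∑ N_j 𝒜¹` is not nilpotent. Some `ρ ∈ R` then fixes a vector `v ≠
0` (`Submodule.exists_mul_eq_self_of_not_isNilpotent`). The module `𝒜¹ v` has dimension at most `d ≤
λ(d) ≤ m`, and it has a basis forming a tree rooted at `v`. Recording the edges in strictly
triangular `X`, `Y` gives a unitriangular, hence invertible, pencil. It sends the tuple of basis
vectors to `v` at the root and `0` elsewhere. Since `v = ρ v` lies in `∑ N_j 𝒜¹ v`, changing only
the root row of `Y` kills this remainder and makes the pencil singular, against `(*)`. So `R` is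
nilpotent, and with it `𝒩 ⊆ 𝒜¹ R`. -/

/-- The bound `λ(d)` is at least the size `d`. -/
theorem le_lengthBound (d : ℕ) : d ≤ lengthBound d := by
  unfold lengthBound
  split_ifs with hd
  · exact hd
  · have hd2 : (2 : ℝ) ≤ d := by exact_mod_cast (by omega : 2 ≤ d)
    have hs : (2 : ℝ) ≤ √(2 * (d : ℝ) ^ 2 / ((d : ℝ) - 1) + 1 / 4) := by
      apply Real.le_sqrt_of_sq_le
      have : (4 : ℝ) ≤ 2 * (d : ℝ) ^ 2 / ((d : ℝ) - 1) := by
        rw [le_div_iff₀ (by linarith)]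
        nlinarith
      linarith
    have : (d : ℝ) ≤ (⌈(d : ℝ) * √(2 * (d : ℝ) ^ 2 / ((d : ℝ) - 1) + 1 / 4)
        + (d : ℝ) / 2 - 2⌉₊ : ℝ) := by
      refine le_trans ?_ (Nat.le_ceil _)
      nlinarith
    exact_mod_cast this

/-- The characteristic polynomial of `-M` is a power of `X`; evaluate it at `1`. -/
theorem Matrix.det_one_add_of_isNilpotent {K ι : Type*} [Field K] [Fintype ι] [DecidableEq ι]
    {M : Matrix ι ι K} (hM : IsNilpotent M) : (1 + M).det = 1 := by
  have hn : IsNilpotent (Matrix.toLin' (-M)) := hM.neg.map (Matrix.toLinAlgEquiv' (R := K))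
  have h := hn.charpoly_eq_X_pow_finrank
  rw [Matrix.charpoly_toLin'] at h
  have h1 := congrArg (Polynomial.eval 1) h
  rw [Matrix.eval_charpoly] at h1
  simpa using h1

/-- Left multiplication by `x` is injective on the finite-dimensional `C`, hence surjective, so it
reaches `1`. -/
theorem Subalgebra.exists_mul_eq_one_of_isUnit {K R : Type*} [Field K] [Ring R] [Algebra K R]
    [FiniteDimensional K R] (C : Subalgebra K R) {x : R} (hx : x ∈ C) (hu : IsUnit x) :
    ∃ y ∈ C, x * y = 1 := by
  have hinj : Function.Injective (LinearMap.mulLeft K (⟨x, hx⟩ : C)) := fun a b hab => by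
    have : x * (a : R) = x * b := congrArg Subtype.val hab
    exact Subtype.ext (hu.mul_left_cancel this)
  obtain ⟨y, hy⟩ := LinearMap.injective_iff_surjective.1 hinj 1
  exact ⟨y, y.2, congrArg Subtype.val hy⟩

theorem idealGeneratedBy_le {K R : Type*} [Field K] [Ring R] [Algebra K R]
    {B : NonUnitalSubalgebra K R} {s : Set R} {I : Submodule K R} (hI : IsIdealOf B I)
    (hs : s ⊆ (I : Set R)) : idealGeneratedBy B s ≤ I := fun _ hx =>
  Submodule.mem_sInf.1 hx I ⟨hI, hs⟩

/-! ### Block matrices with entries in an algebra or an ideal -/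

section Blocks

variable {K : Type*} [Field K] {d n : ℕ}

/-- The `d × d` block of a matrix in `M_d ⊗ M_n` at the position `(p, q)` of `M_n`. -/
def kroneckerBlock (M : Matrix (Fin d × Fin n) (Fin d × Fin n) K) (p q : Fin n) :
    Matrix (Fin d) (Fin d) K :=
  M.submatrix (fun a => (a, p)) (fun b => (b, q))

theorem kroneckerBlock_mul (M M' : Matrix (Fin d × Fin n) (Fin d × Fin n) K) (p q : Fin n) :
    kroneckerBlock (M * M') p q = ∑ s, kroneckerBlock M p s * kroneckerBlock M' s q := by
  ext a b
  simp only [kroneckerBlock, Matrix.submatrix_apply, Matrix.mul_apply, Matrix.sum_apply,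
    Fintype.sum_prod_type]
  exact Finset.sum_comm

theorem kroneckerBlock_kronecker (B : Matrix (Fin d) (Fin d) K) (Z : Matrix (Fin n) (Fin n) K)
    (p q : Fin n) : kroneckerBlock (B ⊗ₖ Z) p q = Z p q • B := by
  ext a b
  simp [kroneckerBlock, mul_comm]

theorem kroneckerBlock_algebraMap (c : K) (p q : Fin n) :
    kroneckerBlock (algebraMap K (Matrix (Fin d × Fin n) (Fin d × Fin n) K) c) p q
      = algebraMap K _ (if p = q then c else 0) := by
  ext a b
  by_cases h : p = q <;> by_cases h' : a = b <;>
    simp [kroneckerBlock, Matrix.algebraMap_matrix_apply, h, h']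

/-- The matrices in `M_d ⊗ M_n` all of whose blocks lie in `I`. -/
def blocksIn (n : ℕ) (I : Submodule K (Matrix (Fin d) (Fin d) K)) :
    Submodule K (Matrix (Fin d × Fin n) (Fin d × Fin n) K) where
  carrier := {M | ∀ p q, kroneckerBlock M p q ∈ I}
  add_mem' h h' p q := I.add_mem (h p q) (h' p q)
  zero_mem' _ _ := I.zero_mem
  smul_mem' c _ h p q := I.smul_mem c (h p q)

theorem mul_mem_blocksIn {I J L : Submodule K (Matrix (Fin d) (Fin d) K)}
    (hIJ : ∀ a ∈ I, ∀ b ∈ J, a * b ∈ L)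
    {M M' : Matrix (Fin d × Fin n) (Fin d × Fin n) K}
    (hM : M ∈ blocksIn n I) (hM' : M' ∈ blocksIn n J) : M * M' ∈ blocksIn n L := fun p q => by
  rw [kroneckerBlock_mul]
  exact L.sum_mem fun s _ => hIJ _ (hM p s) _ (hM' s q)

theorem kronecker_mem_blocksIn {I : Submodule K (Matrix (Fin d) (Fin d) K)}
    {B : Matrix (Fin d) (Fin d) K} (hB : B ∈ I) (Z : Matrix (Fin n) (Fin n) K) :
    B ⊗ₖ Z ∈ blocksIn n I := fun p q => by
  rw [kroneckerBlock_kronecker]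
  exact I.smul_mem _ hB

/-- The algebra `C ⊗ M_n` of matrices all of whose blocks lie in the algebra `C`. -/
def blockSubalgebra (n : ℕ) (C : Subalgebra K (Matrix (Fin d) (Fin d) K)) :
    Subalgebra K (Matrix (Fin d × Fin n) (Fin d × Fin n) K) where
  carrier := blocksIn n (Subalgebra.toSubmodule C)
  add_mem' := (blocksIn n _).add_mem
  mul_mem' := mul_mem_blocksIn fun _ ha _ hb => C.mul_mem ha hb
  algebraMap_mem' c p q := by
    rw [kroneckerBlock_algebraMap]
    exact C.algebraMap_mem _

theorem isNilpotent_of_mem_blocksIn {I : Submodule K (Matrix (Fin d) (Fin d) K)}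
    (hI : IsNilpotent I) {M : Matrix (Fin d × Fin n) (Fin d × Fin n) K}
    (hM : M ∈ blocksIn n I) : IsNilpotent M := by
  obtain ⟨r, hr⟩ := hI
  have hpow : ∀ k : ℕ, M ^ (k + 1) ∈ blocksIn n (I ^ (k + 1)) := fun k => by
    induction k with
    | zero => simpa using hM
    | succ k ih =>
      rw [pow_succ M, pow_succ I]
      exact mul_mem_blocksIn (fun a ha b hb => Submodule.mul_mem_mul ha hb) ih hM
  refine ⟨r + 1, ?_⟩
  have h := hpow r
  rw [pow_succ I, hr, zero_mul] at h
  ext ⟨a, p⟩ ⟨b, q⟩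
  have hpq : kroneckerBlock (M ^ (r + 1)) p q = 0 := h p q
  exact congrFun (congrFun hpq a) b

theorem det_add_eq_of_isUnit {C : Subalgebra K (Matrix (Fin d) (Fin d) K)}
    {I : Submodule K (Matrix (Fin d) (Fin d) K)} (hCI : ∀ a ∈ C, ∀ x ∈ I, a * x ∈ I)
    (hI : IsNilpotent I) {L w : Matrix (Fin d × Fin n) (Fin d × Fin n) K}
    (hL : L ∈ blockSubalgebra n C) (hw : w ∈ blocksIn n I) (hu : L.det ≠ 0) :
    (L + w).det = L.det := by
  obtain ⟨y, hy, hLy⟩ := (blockSubalgebra n C).exists_mul_eq_one_of_isUnit hL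
    ((Matrix.isUnit_iff_isUnit_det L).2 hu.isUnit)
  have hyw : y * w ∈ blocksIn n I := mul_mem_blocksIn hCI hy hw
  have : L + w = L * (1 + y * w) := by rw [mul_add, mul_one, ← mul_assoc, hLy, one_mul]
  rw [this, Matrix.det_mul,
    Matrix.det_one_add_of_isNilpotent (isNilpotent_of_mem_blocksIn hI hyw), mul_one]

/-- If either of `L`, `L + w` is invertible, perturbing it by `±w` gives the equality; otherwise
both determinants vanish. -/
theorem det_add_eq {C : Subalgebra K (Matrix (Fin d) (Fin d) K)}
    {I : Submodule K (Matrix (Fin d) (Fin d) K)} (hCI : ∀ a ∈ C, ∀ x ∈ I, a * x ∈ I)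
    (hI : IsNilpotent I) {L w : Matrix (Fin d × Fin n) (Fin d × Fin n) K}
    (hL : L ∈ blockSubalgebra n C) (hLw : L + w ∈ blockSubalgebra n C) (hw : w ∈ blocksIn n I) :
    (L + w).det = L.det := by
  by_cases hu : L.det = 0
  · by_cases hv : (L + w).det = 0
    · rw [hu, hv]
    · have := det_add_eq_of_isUnit hCI hI hLw ((blocksIn n I).neg_mem hw) hv
      rw [add_neg_cancel_right] at this
      exact this.symm
  · exact det_add_eq_of_isUnit hCI hI hL hw hu

end Blocks

/-! ### The coefficient ideal: part (b), and reduction of (a) to a right ideal -/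

section Coefficients

variable {K : Type*} [Field K] {d g h : ℕ}

/-- The unital algebra generated by `A_1, …, A_g, N_1, …, N_h`. -/
def unitalCoeffAlgebra (A : Fin g → Matrix (Fin d) (Fin d) K)
    (N : Fin h → Matrix (Fin d) (Fin d) K) : Subalgebra K (Matrix (Fin d) (Fin d) K) :=
  Algebra.adjoin K (Set.range A ∪ Set.range N)

variable (A : Fin g → Matrix (Fin d) (Fin d) K) (N : Fin h → Matrix (Fin d) (Fin d) K)

/-- Passing to the unital algebra is needed because inverses of pencils live there; scalars preserve
any subspace. -/
theorem mul_mem_coeffIdeal {a x : Matrix (Fin d) (Fin d) K} (ha : a ∈ unitalCoeffAlgebra A N)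
    (hx : x ∈ coeffIdeal A N) : a * x ∈ coeffIdeal A N := by
  induction ha using Algebra.adjoin_induction generalizing x with
  | mem a ha =>
    exact (coeffIdeal_isIdealOf A N).mul_mem_left a (NonUnitalAlgebra.subset_adjoin K ha) x hx
  | algebraMap c =>
    rw [← Algebra.smul_def]
    exact (coeffIdeal A N).smul_mem c hx
  | add a b _ _ iha ihb =>
    rw [add_mul]
    exact add_mem (iha hx) (ihb hx)
  | mul a b _ _ iha ihb =>
    rw [mul_assoc]
    exact iha (ihb hx)

theorem det_pencilEval_sub_eq (hN : IsNilpotent (coeffIdeal A N)) (n : ℕ)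
    (X : Fin g → Matrix (Fin n) (Fin n) K) (Y : Fin h → Matrix (Fin n) (Fin n) K) :
    (pencilEval A X - ∑ j, N j ⊗ₖ Y j).det = (pencilEval A X).det := by
  have hL : pencilEval A X ∈ blockSubalgebra n (unitalCoeffAlgebra A N) := by
    refine sub_mem (kronecker_mem_blocksIn (one_mem (unitalCoeffAlgebra A N)) _)
      (sum_mem fun i _ => kronecker_mem_blocksIn (Algebra.subset_adjoin (R := K) ?_) _)
    exact Or.inl ⟨i, rfl⟩
  have hw' : ∑ j, N j ⊗ₖ Y j ∈ blockSubalgebra n (unitalCoeffAlgebra A N) := by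
    refine sum_mem fun j _ => kronecker_mem_blocksIn (Algebra.subset_adjoin (R := K) ?_) _
    exact Or.inr ⟨j, rfl⟩
  have hw : ∑ j, N j ⊗ₖ Y j ∈ blocksIn n (coeffIdeal A N) :=
    sum_mem fun j _ => kronecker_mem_blocksIn
      (subset_idealGeneratedBy (coeffAlgebra A N) _ (Set.mem_range_self j)) _
  rw [sub_eq_add_neg]
  refine det_add_eq (fun a ha x hx => mul_mem_coeffIdeal A N ha hx) hN hL ?_ (neg_mem hw)
  rw [← sub_eq_add_neg]
  exact sub_mem hL hw'

/-- The right ideal `∑ j, N_j 𝒜¹` of the unital algebra `𝒜¹` generated by the coefficients. -/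
def coeffRightIdeal : Submodule K (Matrix (Fin d) (Fin d) K) :=
  Submodule.span K (Set.range N) * Subalgebra.toSubmodule (unitalCoeffAlgebra A N)

theorem coeffIdeal_le :
    coeffIdeal A N ≤ Subalgebra.toSubmodule (unitalCoeffAlgebra A N) * coeffRightIdeal A N := by
  set C := Subalgebra.toSubmodule (unitalCoeffAlgebra A N) with hC
  have hCC : C * C = C := Subalgebra.isIdempotentElem_toSubmodule _
  have h1 : (1 : Matrix (Fin d) (Fin d) K) ∈ C := one_mem (unitalCoeffAlgebra A N)
  have hBC : ∀ a ∈ coeffAlgebra A N, a ∈ C := fun a ha =>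
    NonUnitalAlgebra.adjoin_le_algebra_adjoin K _ ha
  -- The intersection provides the containment in the algebra that `IsIdealOf` demands.
  suffices hI : IsIdealOf (coeffAlgebra A N)
      ((C * coeffRightIdeal A N) ⊓ (coeffAlgebra A N).toSubmodule) ∧
      Set.range N ⊆ ((C * coeffRightIdeal A N) ⊓ (coeffAlgebra A N).toSubmodule :
        Submodule K (Matrix (Fin d) (Fin d) K)) from
    (idealGeneratedBy_le hI.1 hI.2).trans inf_le_left
  refine ⟨⟨inf_le_right, ?_, ?_⟩, ?_⟩
  · refine fun a ha x hx => ⟨?_, (coeffAlgebra A N).mul_mem ha hx.2⟩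
    have := Submodule.mul_mem_mul (hBC a ha) hx.1
    rwa [← mul_assoc, hCC] at this
  · refine fun a ha x hx => ⟨?_, (coeffAlgebra A N).mul_mem hx.2 ha⟩
    have := Submodule.mul_mem_mul hx.1 (hBC a ha)
    rwa [coeffRightIdeal, mul_assoc, mul_assoc, hCC] at this
  · rintro _ ⟨j, rfl⟩
    refine ⟨?_, NonUnitalAlgebra.subset_adjoin K (Or.inr ⟨j, rfl⟩)⟩
    have := Submodule.mul_mem_mul h1
      (Submodule.mul_mem_mul (Submodule.subset_span (R := K) (Set.mem_range_self (f := N) j)) h1)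
    rwa [one_mul, mul_one] at this

/-- Since `R C = R`, inner factors `C` are absorbed: `(C R)^(k+1) = C R^(k+1)`. -/
theorem isNilpotent_coeffIdeal (hR : IsNilpotent (coeffRightIdeal A N)) :
    IsNilpotent (coeffIdeal A N) := by
  obtain ⟨r, hr⟩ := hR
  set C := Subalgebra.toSubmodule (unitalCoeffAlgebra A N) with hC
  have hRC : coeffRightIdeal A N * C = coeffRightIdeal A N := by
    rw [coeffRightIdeal, mul_assoc, Subalgebra.isIdempotentElem_toSubmodule]
  have hpow : ∀ k : ℕ, (C * coeffRightIdeal A N) ^ (k + 1) = C * coeffRightIdeal A N ^ (k + 1) :=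
    fun k => by
      induction k with
      | zero => simp
      | succ k ih =>
        rw [pow_succ, ih, mul_assoc, ← mul_assoc _ C, pow_succ _ k, mul_assoc _ _ C, hRC,
          ← pow_succ, ← pow_succ]
  refine ⟨r + 1, ?_⟩
  have h := pow_le_pow_left' (coeffIdeal_le A N) (r + 1)
  rw [hpow, pow_succ (coeffRightIdeal A N), hr, zero_mul, mul_zero] at h
  exact le_bot_iff.1 h

end Coefficients

/-! ### Fixed elements from non-nilpotency -/

/-- The powers of `I` decrease to a nonzero idempotent subspace `Q`. In a minimal nonzero `F` with
`Q F = F`, some `a` has `Q a ≠ 0`; minimality forces `Q a = F ∋ a`. -/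
theorem Submodule.exists_mul_eq_self_of_not_isNilpotent {K R : Type*} [Field K] [Ring R]
    [Algebra K R] [FiniteDimensional K R] {I : Submodule K R} (hII : I * I ≤ I)
    (hI : ¬ IsNilpotent I) : ∃ ρ ∈ I, ∃ a ≠ 0, ρ * a = a := by
  have hanti : Antitone fun k : ℕ => I ^ (k + 1) := antitone_nat_of_succ_le fun k => by
    rw [pow_succ I (k + 1), pow_succ I k, mul_assoc]
    exact mul_le_mul' le_rfl hII
  obtain ⟨n, hn⟩ := IsArtinian.monotone_stabilizes (R := K) (M := R)
    ⟨fun k => OrderDual.toDual (I ^ (k + 1)), fun _ _ hab => hanti hab⟩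
  set Q := I ^ (n + 1) with hQ
  have hQQ : Q * Q = Q := by
    have : I ^ (n + 1) = I ^ (n + 1 + n + 1) := hn (n + 1 + n) (by omega)
    rw [hQ, ← pow_add, ← add_assoc, ← this]
  have hQI : Q ≤ I := by simpa using hanti (Nat.zero_le n)
  obtain ⟨F, ⟨hQF, hF0⟩, hmin⟩ := IsArtinian.set_has_minimal (R := K) (M := R)
    {F | Q * F = F ∧ F ≠ ⊥} ⟨Q, hQQ, fun h => hI ⟨n + 1, h⟩⟩
  obtain ⟨a, haF, ha⟩ : ∃ a ∈ F, Q * Submodule.span K {a} ≠ ⊥ := by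
    by_contra! hcon
    refine hF0 (le_bot_iff.1 (hQF ▸ Submodule.mul_le.2 fun q hq a ha => ?_))
    rw [← hcon a ha]
    exact Submodule.mul_mem_mul hq (Submodule.mem_span_singleton_self a)
  have hGF : Q * Submodule.span K {a} ≤ F := by
    conv_rhs => rw [← hQF]
    exact mul_le_mul' le_rfl ((Submodule.span_singleton_le_iff_mem _ _).2 haF)
  have hG : Q * Submodule.span K {a} = F := by
    by_contra hne
    exact hmin _ ⟨by rw [← mul_assoc, hQQ], ha⟩ (lt_of_le_of_ne hGF hne)
  rw [← hG] at haF
  obtain ⟨ρ, hρ, hρa⟩ := Submodule.mem_mul_span_singleton.1 haF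
  refine ⟨ρ, hQI hρ, a, ?_, hρa⟩
  rintro rfl
  simp at ha

/-! ### Tree-shaped bases of cyclic modules -/

section SpanningTree

variable {K V ι : Type*} [Field K] [AddCommGroup V] [Module K V] [FiniteDimensional K V]

/-- The cyclic submodule generated by a nonzero vector under a family of endomorphisms has a
basis that forms a tree: each basis vector but the root is obtained by applying one of the
endomorphisms to an earlier one. -/
theorem exists_spanning_tree [Nonempty ι] (B : ι → Module.End K V) {v : V} (hv : v ≠ 0) :
    ∃ k ≤ Module.finrank K V, ∃ (u : ℕ → V) (π : ℕ → ℕ) (b : ℕ → ι), 0 < k ∧ u 0 = v ∧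
      (∀ p, 0 < p → p < k → π p < p ∧ u p = B (b p) (u (π p))) ∧
      ∀ i, ∀ q < k, B i (u q) ∈ Submodule.span K (Set.range fun p : Fin k => u p) := by
  by_contra hcon
  -- If no tree ever spans a stable subspace, each can be extended by one independent vector,
  -- eventually exceeding the dimension.
  have key : ∀ k : ℕ, ∃ (u : ℕ → V) (π : ℕ → ℕ) (b : ℕ → ι), u 0 = v ∧
      (∀ p, 0 < p → p < k + 1 → π p < p ∧ u p = B (b p) (u (π p))) ∧
      LinearIndependent K fun p : Fin (k + 1) => u p := by
    intro k
    induction k with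
    | zero =>
      refine ⟨fun _ => v, id, fun _ => Classical.arbitrary ι, rfl, fun p h h' => by omega, ?_⟩
      rw [zero_add, linearIndependent_unique_iff]
      exact hv
    | succ k ih =>
      obtain ⟨u, π, b, h0, htree, hli⟩ := ih
      obtain ⟨i, q, hq, hiq⟩ : ∃ i, ∃ q < k + 1,
          B i (u q) ∉ Submodule.span K (Set.range fun p : Fin (k + 1) => u p) := by
        by_contra! hstable
        exact hcon ⟨k + 1, by simpa using hli.fintype_card_le_finrank, u, π, b, k.succ_pos, h0,
          htree, hstable⟩
      refine ⟨Function.update u (k + 1) (B i (u q)), Function.update π (k + 1) q,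
        Function.update b (k + 1) i, by simpa using h0, fun p hp hpk => ?_, ?_⟩
      · rcases Nat.lt_succ_iff_lt_or_eq.1 hpk with hlt | rfl
        · obtain ⟨h1, h2⟩ := htree p hp hlt
          rw [Function.update_of_ne hlt.ne, Function.update_of_ne hlt.ne,
            Function.update_of_ne hlt.ne, Function.update_of_ne (h1.trans hlt).ne]
          exact ⟨h1, h2⟩
        · simp [hq, hq.ne]
      · have hinit : (Fin.init fun p : Fin (k + 1 + 1) =>
            Function.update u (k + 1) (B i (u q)) p) = fun p : Fin (k + 1) => u p := by
          funext p
          simp [Fin.init, p.2.ne]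
        rw [linearIndependent_finSucc', hinit]
        exact ⟨hli, by simpa using hiq⟩
  obtain ⟨u, π, b, -, -, hli⟩ := key (Module.finrank K V)
  simpa using hli.fintype_card_le_finrank

/-- Matrix form of `exists_spanning_tree`: the edges of the tree are recorded by strictly
lower triangular matrices, one for each endomorphism of the family. -/
theorem exists_triangular_of_finrank_le [Nonempty ι] [Fintype ι] (B : ι → Module.End K V)
    {v : V} (hv : v ≠ 0) {m : ℕ} (hm : Module.finrank K V ≤ m) :
    ∃ (r : Fin m) (w : Fin m → V) (Z : ι → Matrix (Fin m) (Fin m) K), w r = v ∧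
      (∀ i p q, Z i p q ≠ 0 → q < p) ∧
      (∀ p, ∑ i, ∑ q, Z i p q • B i (w q) = if p = r then 0 else w p) ∧
      ∀ i q, B i (w q) ∈ Submodule.span K (Set.range w) := by
  classical
  obtain ⟨k, hk, u, π, b, hk0, h0, htree, hstable⟩ := exists_spanning_tree B hv
  have hkm := hk.trans hm
  -- The tree has `k ≤ m` vertices; the remaining positions are padded with zero vectors and zero
  -- rows of `Z`.
  set w : Fin m → V := fun p => if p.val < k then u p else 0 with hw
  -- Row `p` of a non-root vertex has a single `1`, in the column of its parent and in the matrix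
  -- labelling the edge.
  set Z : ι → Matrix (Fin m) (Fin m) K := fun i p q =>
    if (p.val < k ∧ 0 < p.val) ∧ q.val = π p ∧ i = b p then 1 else 0 with hZdef
  have hZ0 : ∀ (i : ι) (p q : Fin m) (x : V), ¬ ((p.val < k ∧ 0 < p.val) ∧ q.val = π p ∧ i = b p) →
      Z i p q • x = 0 := fun i p q x hn => by
    rw [show Z i p q = 0 from if_neg hn, zero_smul]
  refine ⟨⟨0, hk0.trans_le hkm⟩, w, Z,
    by simp [hw, hk0, h0], fun i p q hZ => ?_, fun p => ?_, fun i q => ?_⟩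
  · obtain ⟨⟨h1, h2⟩, h3, -⟩ := of_not_not fun hn => hZ (if_neg hn)
    exact Fin.lt_def.2 (h3 ▸ (htree p h2 h1).1)
  · by_cases hp : p.val < k ∧ 0 < p.val
    · obtain ⟨h1, h2⟩ := htree p hp.2 hp.1
      have hne : p ≠ ⟨0, hk0.trans_le hkm⟩ := fun h => by simp [h] at hp
      rw [if_neg hne, Finset.sum_eq_single (b p), Finset.sum_eq_single ⟨π p, h1.trans p.2⟩]
      · simp [hZdef, hp, hw, h1.trans hp.1, h2]
      · intro q _ hq
        exact hZ0 _ _ _ _ fun h => hq (Fin.ext h.2.1)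
      · simp
      · intro i _ hi
        exact Finset.sum_eq_zero fun q _ => hZ0 _ _ _ _ fun h => hi h.2.2
      · simp
    · rw [Finset.sum_eq_zero fun i _ => Finset.sum_eq_zero fun q _ => 
        hZ0 _ _ _ _ fun h => hp h.1]
      split_ifs with hr
      · rfl
      · have : ¬ p.val < k := fun h => hp ⟨h, Nat.pos_of_ne_zero fun h0 => hr (Fin.ext h0)⟩
        simp [hw, this]
  · by_cases hq : q.val < k
    · have hle : Submodule.span K (Set.range fun p : Fin k => u p) ≤
          Submodule.span K (Set.range w) := by
        refine Submodule.span_mono ?_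
        rintro _ ⟨p, rfl⟩
        exact ⟨⟨p, p.2.trans_le hkm⟩, by simp [hw]⟩
      have := hle (hstable i q hq)
      simpa [hw, hq] using this
    · simp [hw, hq]

end SpanningTree

/-! ### Part (a): an invertible pencil made singular by changing `Y` -/

section Coefficients

variable {K : Type*} [Field K] {d g h : ℕ}

theorem Matrix.kronecker_mulVec_apply {m : ℕ} (B : Matrix (Fin d) (Fin d) K)
    (Z : Matrix (Fin m) (Fin m) K) (w : Fin m → Fin d → K) (a : Fin d) (p : Fin m) :
    ((B ⊗ₖ Z).mulVec fun x => w x.2 x.1) (a, p) = (∑ q, Z p q • B.mulVec (w q)) a := by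
  simp only [Matrix.mulVec, dotProduct, Matrix.kroneckerMap_apply, Fintype.sum_prod_type,
    Finset.sum_apply, Pi.smul_apply, smul_eq_mul, Finset.mul_sum]
  rw [Finset.sum_comm]
  exact Finset.sum_congr rfl fun q _ => Finset.sum_congr rfl fun b _ => by ring

variable (A : Fin g → Matrix (Fin d) (Fin d) K) (N : Fin h → Matrix (Fin d) (Fin d) K)

theorem pencilEval_sub_mulVec_apply {m : ℕ} (X : Fin g → Matrix (Fin m) (Fin m) K)
    (Y : Fin h → Matrix (Fin m) (Fin m) K) (w : Fin m → Fin d → K) (a : Fin d) (p : Fin m) :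
    ((pencilEval A X - ∑ j, N j ⊗ₖ Y j).mulVec fun x => w x.2 x.1) (a, p) =
      (w p - ∑ i, ∑ q, X i p q • (A i).mulVec (w q)
        - ∑ j, ∑ q, Y j p q • (N j).mulVec (w q)) a := by
  simp only [pencilEval, Matrix.one_kronecker_one, Matrix.sub_mulVec, Matrix.one_mulVec,
    Matrix.sum_mulVec, Pi.sub_apply, Finset.sum_apply a, Finset.sum_apply (a, p),
    Matrix.kronecker_mulVec_apply]

/-- Forward substitution: the `p`-th component of a kernel vector is determined by the earlier ones,
so all vanish. -/
theorem det_pencilEval_sub_ne_zero {m : ℕ} {X : Fin g → Matrix (Fin m) (Fin m) K}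
    {Y : Fin h → Matrix (Fin m) (Fin m) K} (hX : ∀ i p q, X i p q ≠ 0 → q < p)
    (hY : ∀ j p q, Y j p q ≠ 0 → q < p) : (pencilEval A X - ∑ j, N j ⊗ₖ Y j).det ≠ 0 := by
  intro hdet
  obtain ⟨x, hx0, hx⟩ := Matrix.exists_mulVec_eq_zero_iff.2 hdet
  set w : Fin m → Fin d → K := fun p a => x (a, p) with hw
  have hrec : ∀ p, (∀ q < p, w q = 0) → w p = 0 := fun p ih => by
    have hz : ∀ (Z : K) (M : Matrix (Fin d) (Fin d) K) (q : Fin m), (Z ≠ 0 → q < p) →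
        Z • M.mulVec (w q) = 0 := fun Z M q hZ => by
      by_cases h0 : Z = 0
      · rw [h0, zero_smul]
      · rw [ih q (hZ h0), Matrix.mulVec_zero, smul_zero]
    funext a
    have := pencilEval_sub_mulVec_apply A N X Y w a p
    rw [Finset.sum_eq_zero fun i _ => Finset.sum_eq_zero fun q _ => hz _ _ q (hX i p q),
      Finset.sum_eq_zero fun j _ => Finset.sum_eq_zero fun q _ => hz _ _ q (hY j p q),
      sub_zero, sub_zero] at this
    rw [← this]
    exact congrFun hx (a, p)
  have hall : ∀ p, w p = 0 := fun p => by
    induction p using WellFoundedLT.induction with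
    | ind p ih => exact hrec p ih
  exact hx0 (funext fun y => congrFun (hall y.2) y.1)

/-- The span of `w` is an `𝒜¹`-module, and `ρ` is a sum of products `N_j c` with `c ∈ 𝒜¹`. -/
theorem mulVec_mem_span_of_mem_coeffRightIdeal {α : Type*} {w : α → Fin d → K}
    (hA : ∀ i q, (A i).mulVec (w q) ∈ Submodule.span K (Set.range w))
    (hN : ∀ j q, (N j).mulVec (w q) ∈ Submodule.span K (Set.range w))
    {ρ : Matrix (Fin d) (Fin d) K} (hρ : ρ ∈ coeffRightIdeal A N) (r : α) :
    ρ.mulVec (w r) ∈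
      Submodule.span K (Set.range fun x : Fin h × α => (N x.1).mulVec (w x.2)) := by
  have hC : ∀ a ∈ unitalCoeffAlgebra A N, ∀ s ∈ Submodule.span K (Set.range w),
      a.mulVec s ∈ Submodule.span K (Set.range w) := by
    intro a ha
    induction ha using Algebra.adjoin_induction with
    | mem a ha =>
      have hle : Submodule.span K (Set.range w) ≤
          (Submodule.span K (Set.range w)).comap a.mulVecLin := by
        rw [Submodule.span_le]
        rintro _ ⟨q, rfl⟩
        rcases ha with ⟨i, rfl⟩ | ⟨j, rfl⟩
        · exact hA i q
        · exact hN j q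
      exact fun s hs => hle hs
    | algebraMap c =>
      intro s hs
      rw [Algebra.algebraMap_eq_smul_one, Matrix.smul_mulVec, Matrix.one_mulVec]
      exact Submodule.smul_mem _ c hs
    | add a b _ _ iha ihb =>
      intro s hs
      rw [Matrix.add_mulVec]
      exact add_mem (iha s hs) (ihb s hs)
    | mul a b _ _ iha ihb =>
      intro s hs
      rw [← Matrix.mulVec_mulVec]
      exact iha _ (ihb s hs)
  set T := Submodule.span K (Set.range fun x : Fin h × α => (N x.1).mulVec (w x.2)) with hT
  have hNT : ∀ j, Submodule.span K (Set.range w) ≤ T.comap (N j).mulVecLin := fun j => by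
    rw [Submodule.span_le]
    rintro _ ⟨q, rfl⟩
    exact Submodule.subset_span ⟨(j, q), rfl⟩
  induction hρ using Submodule.mul_induction_on' with
  | mem_mul_mem M hM a ha =>
    rw [← Matrix.mulVec_mulVec]
    have hs := hC a ha _ (Submodule.subset_span ⟨r, rfl⟩)
    induction hM using Submodule.span_induction with
    | mem M hM =>
      obtain ⟨j, rfl⟩ := hM
      exact hNT j hs
    | zero => simp
    | add M M' _ _ ih ih' =>
      rw [Matrix.add_mulVec]
      exact add_mem ih ih'
    | smul c M _ ih =>
      rw [Matrix.smul_mulVec]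
      exact T.smul_mem c ih
  | add M _ M' _ ih ih' =>
    rw [Matrix.add_mulVec]
    exact add_mem ih ih'

theorem isNilpotent_coeffRightIdeal {m : ℕ} (hm : d ≤ m)
    (hdet : ∀ (X : Fin g → Matrix (Fin m) (Fin m) K) (Y : Fin h → Matrix (Fin m) (Fin m) K),
      (pencilEval A X - ∑ j, N j ⊗ₖ Y j).det = (pencilEval A X).det) :
    IsNilpotent (coeffRightIdeal A N) := by
  by_contra hnil
  have hmul : coeffRightIdeal A N * coeffRightIdeal A N ≤ coeffRightIdeal A N := by
    have hC : Subalgebra.toSubmodule (unitalCoeffAlgebra A N) * (Submodule.span K (Set.range N) *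
        Subalgebra.toSubmodule (unitalCoeffAlgebra A N)) ≤
        Subalgebra.toSubmodule (unitalCoeffAlgebra A N) := by
      have hN : Submodule.span K (Set.range N) ≤
          Subalgebra.toSubmodule (unitalCoeffAlgebra A N) :=
        Submodule.span_le.2 (Set.subset_union_right.trans Algebra.subset_adjoin)
      calc _ ≤ Subalgebra.toSubmodule (unitalCoeffAlgebra A N) *
            (Subalgebra.toSubmodule (unitalCoeffAlgebra A N) *
              Subalgebra.toSubmodule (unitalCoeffAlgebra A N)) :=
            mul_le_mul' le_rfl (mul_le_mul' hN le_rfl)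
        _ = _ := by
            rw [Subalgebra.isIdempotentElem_toSubmodule, Subalgebra.isIdempotentElem_toSubmodule]
    conv_lhs => rw [coeffRightIdeal, mul_assoc]
    exact mul_le_mul' le_rfl hC
  obtain ⟨ρ, hρ, a, ha0, hρa⟩ := Submodule.exists_mul_eq_self_of_not_isNilpotent hmul hnil
  -- A nonzero column of `a` is the vector fixed by `ρ`; it becomes the root of the tree.
  obtain ⟨c, hc⟩ : ∃ c, a.col c ≠ 0 := by
    by_contra! hcol
    exact ha0 (Matrix.ext fun i j => congrFun (hcol j) i)
  have hρv : ρ.mulVec (a.col c) = a.col c := by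
    conv_rhs => rw [← hρa]
    rfl
  have : Nonempty (Fin h) := by
    by_contra hempty
    rw [not_nonempty_iff] at hempty
    exact hnil ⟨1, by simp [coeffRightIdeal, Set.range_eq_empty]⟩
  obtain ⟨r, w, Z, hwr, hZ, hsum, hstable⟩ := exists_triangular_of_finrank_le
    (fun s : Fin g ⊕ Fin h => (Sum.elim A N s).mulVecLin) hc (m := m) (by simpa using hm)
  have hmem := mulVec_mem_span_of_mem_coeffRightIdeal A N (w := w)
    (fun i q => hstable (Sum.inl i) q) (fun j q => hstable (Sum.inr j) q) hρ r
  rw [hwr, hρv, Submodule.mem_span_range_iff_exists_fun] at hmem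
  obtain ⟨e, he⟩ := hmem
  rw [Fintype.sum_prod_type] at he
  set X : Fin g → Matrix (Fin m) (Fin m) K := fun i => Z (Sum.inl i)
  set Y : Fin h → Matrix (Fin m) (Fin m) K := fun j => Z (Sum.inr j)
  -- Only the root row is nonzero; its entries are the coefficients of `v = ∑ e (j, q) N_j w_q`,
  -- which cancel the remainder `v` there.
  set Y' : Fin h → Matrix (Fin m) (Fin m) K := fun j => Matrix.of fun p q =>
    if p = r then e (j, q) else 0
  -- By `(*)` the determinants at `(X, Y)` and `(X, Y + Y')` agree; the first is nonzero by
  -- triangularity, and the second vanishes because `w` lies in the kernel.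
  refine det_pencilEval_sub_ne_zero A N (fun i => hZ (Sum.inl i)) (fun j => hZ (Sum.inr j))
    ((hdet X Y).trans ((hdet X (Y + Y')).symm.trans ?_))
  refine Matrix.exists_mulVec_eq_zero_iff.1 ⟨fun x => w x.2 x.1, fun h0 => ?_, ?_⟩
  · refine hc (hwr ▸ funext fun b => ?_)
    exact congrFun h0 (b, r)
  · funext ⟨b, p⟩
    have hp := hsum p
    rw [Fintype.sum_sum_type] at hp
    have hY' : ∑ j, ∑ q, Y' j p q • (N j).mulVec (w q) = if p = r then w p else 0 := by
      split_ifs with hpr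
      · rw [hpr, hwr, ← he]
        simp [Y']
      · simp [Y', hpr]
    have htot : w p - ∑ i, ∑ q, X i p q • (A i).mulVec (w q)
        - ∑ j, ∑ q, (Y + Y') j p q • (N j).mulVec (w q) = 0 := by
      simp only [Pi.add_apply, Matrix.add_apply, add_smul, Finset.sum_add_distrib, hY']
      have hp' : ∑ i, ∑ q, X i p q • (A i).mulVec (w q) +
          ∑ j, ∑ q, Y j p q • (N j).mulVec (w q) = if p = r then 0 else w p := hp
      rw [sub_sub, ← add_assoc, hp']
      split_ifs <;> simp
    rw [pencilEval_sub_mulVec_apply, htot]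
    rfl

end Coefficients

/-- `IsNilpotent (coeffIdeal A N)` says that some power of the ideal, that is the span of all
products of `r` of its elements for some `r`, is zero. -/
theorem proposition3p2 {K : Type*} [Field K] [CharZero K] {d g h : ℕ}
    (A : Fin g → Matrix (Fin d) (Fin d) K) (N : Fin h → Matrix (Fin d) (Fin d) K) :
    (∀ m : ℕ, lengthBound d ≤ m →
      (∀ (X : Fin g → Matrix (Fin m) (Fin m) K) (Y : Fin h → Matrix (Fin m) (Fin m) K),
        (pencilEval A X - ∑ j, N j ⊗ₖ Y j).det = (pencilEval A X).det) →
      IsNilpotent (coeffIdeal A N)) ∧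
    (IsNilpotent (coeffIdeal A N) →
      ∀ (n : ℕ) (X : Fin g → Matrix (Fin n) (Fin n) K) (Y : Fin h → Matrix (Fin n) (Fin n) K),
        (pencilEval A X - ∑ j, N j ⊗ₖ Y j).det = (pencilEval A X).det) :=
  ⟨fun _ hm hdet => isNilpotent_coeffIdeal A N
    (isNilpotent_coeffRightIdeal A N ((le_lengthBound d).trans hm) hdet),
    det_pencilEval_sub_eq A N⟩
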